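/- Let $\mathcal H$ be a separable complex Hilbert space (finite- or infinite-dimensional), $\mathcal B(\mathcal H)$ the bounded linear operators on $\mathcal H$, and $I$ the identity operator. A *density operator* is a positive trace class operator $\rho$ on $\mathcal H$ with $\operatorname{tr}(\rho)=1$; its von Neumann entropy is $S(\rho)=-\operatorname{tr}(\rho\log_2\rho)\in[0,\infty]$, where $0\log_2 0=0$. A *bi-stochastic quantum operation* is a normal (that is, ultraweakly continuous) completely positive linear map $\Phi:\mathcal B(\mathcal H)\to\mathcal B(\mathcal H)$ that is unital, $\Phi(I)=I$, and trace-preserving, that is, for every trace class operator $T$ the operator $\Phi(T)$ is of trace class and $\operatorname{tr}(\Phi(T))=\operatorname{tr}(T)$. **Proposition 3.5.** Let $\Phi$ be a bi-stochastic quantum operation on $\mathcal B(\mathcal H)$ and let $\rho$ be an injective density operator on $\mathcal H$. If $S(\Phi(\rho))=S(\rho)<\infty$, then there exists a unitary operator $U$ on $\mathcal H$ such that $\Phi(\rho)=U\rho U^*$. -/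

import Mathlib

open scoped ENNReal Topology CStarAlgebra InnerProductSpace

noncomputable section

namespace QuantumEntropy

variable {H : Type*} [NormedAddCommGroup H] [InnerProductSpace ℂ H] [CompleteSpace H]

/-- The index set of a fixed (chosen) orthonormal basis of the Hilbert space `H`. -/
def basisIndex (H : Type*) [NormedAddCommGroup H] [InnerProductSpace ℂ H] [CompleteSpace H] :
    Set H :=
  (exists_hilbertBasis ℂ H).choose

/-- A fixed (chosen) orthonormal basis of the Hilbert space `H`, used to write down traces. -/
def chosenBasis (H : Type*) [NormedAddCommGroup H] [InnerProductSpace ℂ H] [CompleteSpace H] :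
    HilbertBasis (basisIndex H) ℂ H :=
  (exists_hilbertBasis ℂ H).choose_spec.choose

/-- The trace `∑ᵢ ⟨T eᵢ, eᵢ⟩ ∈ [0, ∞]` of a positive bounded operator `T`. -/
def posTrace (T : H →L[ℂ] H) : ℝ≥0∞ :=
  ∑' i, ENNReal.ofReal (⟪chosenBasis H i, T (chosenBasis H i)⟫_ℂ).re

/-- `T` is of trace class: its absolute value `|T| = (T* T)^(1/2)` has finite trace. -/
def IsTraceClass (T : H →L[ℂ] H) : Prop :=
  posTrace (CFC.abs T) < ∞

/-- The trace `∑ᵢ ⟨T eᵢ, eᵢ⟩` of a trace class operator `T` (the family is then summable). -/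
def trace (T : H →L[ℂ] H) : ℂ :=
  ∑' i, ⟪chosenBasis H i, T (chosenBasis H i)⟫_ℂ

/-- Density operators (states): positive trace class operators of trace one. -/
structure IsDensityOperator (ρ : H →L[ℂ] H) : Prop where
  nonneg : 0 ≤ ρ
  isTraceClass : IsTraceClass ρ
  trace_eq_one : trace ρ = 1

/-- The von Neumann entropy `S(ρ) = - tr (ρ log₂ ρ) ∈ [0, ∞]`. For a density operator `ρ`, whose
spectrum lies in `[0, 1]`, the operator `- ρ log₂ ρ` is the continuous functional calculus of `ρ`
at the continuous function `x ↦ - x log₂ x` (with `0 log₂ 0 = 0`), and it is positive. -/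
def entropy (ρ : H →L[ℂ] H) : ℝ≥0∞ :=
  posTrace (cfc (fun x : ℝ => -(x * Real.logb 2 x)) ρ)

/-- The ultraweak (σ-weak) topology on `B(H)`: the coarsest topology for which all functionals
`T ↦ ∑ₙ ⟨T xₙ, yₙ⟩` with `∑ₙ ‖xₙ‖² < ∞` and `∑ₙ ‖yₙ‖² < ∞` are continuous. -/
@[reducible] def ultraweakTopology (H : Type*) [NormedAddCommGroup H] [InnerProductSpace ℂ H] :
    TopologicalSpace (H →L[ℂ] H) :=
  ⨅ p : lp (fun _ : ℕ => H) 2 × lp (fun _ : ℕ => H) 2,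
    TopologicalSpace.induced (fun T : H →L[ℂ] H => ∑' n, ⟪p.2 n, T (p.1 n)⟫_ℂ) inferInstance

/-- A completely positive map on `B(H)` is normal if it is ultraweakly continuous. -/
def IsNormal (Φ : (H →L[ℂ] H) →CP (H →L[ℂ] H)) : Prop :=
  Continuous[ultraweakTopology H, ultraweakTopology H] Φ

/-- Quantum operations: normal completely positive maps `Φ` on `B(H)` with `Φ(I) ≤ I`. -/
structure IsQuantumOperation (Φ : (H →L[ℂ] H) →CP (H →L[ℂ] H)) : Prop where
  isNormal : IsNormal Φ
  map_one_le : Φ 1 ≤ 1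

/-- `Φ` maps trace class operators to trace class operators and preserves their trace. -/
def IsTracePreserving (Φ : (H →L[ℂ] H) →CP (H →L[ℂ] H)) : Prop :=
  ∀ T : H →L[ℂ] H, IsTraceClass T → IsTraceClass (Φ T) ∧ trace (Φ T) = trace T

/-- Bi-stochastic quantum operations: trace-preserving and unital ones. -/
structure IsBistochastic (Φ : (H →L[ℂ] H) →CP (H →L[ℂ] H)) : Prop
    extends IsQuantumOperation Φ where
  isTracePreserving : IsTracePreserving Φ
  map_one : Φ 1 = 1

/-- Parseval's identity in `[0, ∞]`. -/
theorem tsum_enorm_inner_sq {ι : Type*} (b : HilbertBasis ι ℂ H) (x : H) :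
    ∑' i, ENNReal.ofReal (‖⟪b i, x⟫_ℂ‖ ^ 2) = ENNReal.ofReal (‖x‖ ^ 2) := by
  have h := (b.hasSum_inner_mul_inner x x).mapL Complex.reCLM
  have h2 : HasSum (fun i => ‖⟪b i, x⟫_ℂ‖ ^ 2) (‖x‖ ^ 2) := by
    convert h using 1
    · funext i
      rw [← inner_conj_symm x (b i), ← Complex.normSq_eq_conj_mul_self, Complex.normSq_eq_norm_sq]
      simp [← Complex.ofReal_pow]
    · simp [inner_self_eq_norm_sq_to_K, ← Complex.ofReal_pow]
  rw [← h2.tsum_eq, ENNReal.ofReal_tsum_of_nonneg (fun _ => by positivity) h2.summable]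

/-- The trace of a positive operator can be computed in every orthonormal basis. -/
theorem posTrace_eq {T : H →L[ℂ] H} (hT : 0 ≤ T) {ι : Type*} (b : HilbertBasis ι ℂ H) :
    posTrace T = ∑' i, ENNReal.ofReal (⟪b i, T (b i)⟫_ℂ).re := by
  have hS : IsSelfAdjoint (CFC.sqrt T) := (CFC.sqrt_nonneg T).isSelfAdjoint
  have hadj : ∀ x y : H, ⟪CFC.sqrt T x, y⟫_ℂ = ⟪x, CFC.sqrt T y⟫_ℂ := hS.isSymmetric
  have key : ∀ x : H, (⟪x, T x⟫_ℂ).re = ‖CFC.sqrt T x‖ ^ 2 := by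
    intro x
    have h : T x = CFC.sqrt T (CFC.sqrt T x) := by
      conv_lhs => rw [← CFC.sqrt_mul_sqrt_self T hT]
      rfl
    rw [h, ← hadj, inner_self_eq_norm_sq_to_K]
    simp [← Complex.ofReal_pow]
  unfold posTrace
  simp_rw [key]
  calc ∑' i, ENNReal.ofReal (‖CFC.sqrt T (chosenBasis H i)‖ ^ 2)
      = ∑' i, ∑' j, ENNReal.ofReal (‖⟪b j, CFC.sqrt T (chosenBasis H i)⟫_ℂ‖ ^ 2) := by
        simp_rw [tsum_enorm_inner_sq b]
    _ = ∑' j, ∑' i, ENNReal.ofReal (‖⟪b j, CFC.sqrt T (chosenBasis H i)⟫_ℂ‖ ^ 2) :=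
        ENNReal.tsum_comm
    _ = ∑' j, ∑' i, ENNReal.ofReal (‖⟪chosenBasis H i, CFC.sqrt T (b j)⟫_ℂ‖ ^ 2) := by
        simp_rw [← hadj (b _), norm_inner_symm (CFC.sqrt T (b _))]
    _ = ∑' j, ENNReal.ofReal (‖CFC.sqrt T (b j)‖ ^ 2) := by
        simp_rw [tsum_enorm_inner_sq (chosenBasis H)]

end QuantumEntropy

end

/-! Let `ρ` have eigenvalues `aᵢ` in an orthonormal basis `eᵢ`, and `Φ ρ` eigenvalues `bⱼ` in an
orthonormal basis `fⱼ`; such bases exist because positive operators of finite trace are compact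
(`exists_hilbertBasis_eigenvectors`). Put `dᵢⱼ = ⟨fⱼ, Φ(|eᵢ⟩⟨eᵢ|) fⱼ⟩ ≥ 0`. Preservation of the trace
gives `∑ⱼ dᵢⱼ = 1`, while normality (`IsNormal.hasSum_inner`) gives `∑ᵢ dᵢⱼ = 1` and
`∑ᵢ dᵢⱼ aᵢ = bⱼ`. So `b` arises from `a` by a doubly stochastic array, and the concavity of
`η x = -x log₂ x` shows `S(Φ ρ) = ∑ⱼ η(bⱼ) ≥ ∑ᵢ η(aᵢ) = S(ρ)`.

The defect in this inequality is exactly `∑ⱼ ∑ᵢ dᵢⱼ g(aᵢ, bⱼ)`, where `g(x, m) ≥ 0` is the gap at `x`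
between `η` and its tangent line at `m`, which vanishes only for `x = m`. If the entropies agree and
are finite, then `dᵢⱼ ≠ 0` forces `aᵢ = bⱼ` (`exists_equiv_of_entropy_eq`). The array `d` is thus
block diagonal with respect to the values of `a` and `b`. Each block is doubly stochastic, hence has
as many rows as columns; by injectivity of `ρ` all `aᵢ` are positive, so the blocks are finite.
Matching the blocks gives a bijection between the two bases that respects eigenvalues
(`exists_equiv_of_doublyStochastic`), and hence the unitary operator.
-/

namespace QuantumEntropy

universe u

/-! ### Strict concavity of `x ↦ -x log₂ x` and doubly stochastic arrays -/

/-- The gap between the function `x ↦ -x log₂ x` and its tangent line at `m`, evaluated at `x`. -/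
noncomputable def entropyGap (x m : ℝ) : ℝ :=
  (m - x) / Real.log 2 - x * Real.logb 2 m + x * Real.logb 2 x

theorem entropyGap_eq {x m : ℝ} (hx : 0 < x) (hm : 0 < m) :
    entropyGap x m = x / Real.log 2 * (m / x - 1 - Real.log (m / x)) := by
  rw [entropyGap, Real.log_div hm.ne' hx.ne', Real.logb, Real.logb]
  field_simp
  ring

theorem entropyGap_nonneg {x m : ℝ} (hx : 0 < x) (hm : 0 < m) : 0 ≤ entropyGap x m := by
  rw [entropyGap_eq hx hm]
  have := Real.log_le_sub_one_of_pos (div_pos hm hx)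
  have h2 := Real.log_pos one_lt_two
  exact mul_nonneg (by positivity) (by linarith)

theorem eq_of_entropyGap_eq_zero {x m : ℝ} (hx : 0 < x) (hm : 0 < m) (h : entropyGap x m = 0) :
    m = x := by
  by_contra hne
  have h1 : m / x ≠ 1 := by rwa [Ne, div_eq_one_iff_eq hx.ne']
  have := Real.log_lt_sub_one_of_pos (div_pos hm hx) h1
  have h2 := Real.log_pos one_lt_two
  have h3 : 0 < entropyGap x m := by
    rw [entropyGap_eq hx hm]
    exact mul_pos (by positivity) (by linarith)
  exact h3.ne' h

theorem neg_mul_logb_nonneg {x : ℝ} (h0 : 0 ≤ x) (h1 : x ≤ 1) : 0 ≤ -(x * Real.logb 2 x) := by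
  have := Real.logb_nonpos one_lt_two h0 h1
  nlinarith

section DoublyStochastic

variable {ι κ : Type*}

/-- Summing the tangent lines at the mean turns Jensen's inequality for a probability vector `w`
into an identity whose defect is the averaged gap. -/
theorem hasSum_mul_add_entropyGap {w a : ι → ℝ} {m : ℝ} (hw : HasSum w 1)
    (hm : HasSum (fun i => w i * a i) m) :
    HasSum (fun i => w i * (-(a i * Real.logb 2 (a i)) + entropyGap (a i) m))
      (-(m * Real.logb 2 m)) := by
  have h := ((hw.mul_right (m / Real.log 2)).sub (hm.mul_right (1 / Real.log 2))).sub
    (hm.mul_right (Real.logb 2 m))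
  have hval : 1 * (m / Real.log 2) - m * (1 / Real.log 2) - m * Real.logb 2 m =
      -(m * Real.logb 2 m) := by ring
  rw [hval] at h
  refine h.congr_fun fun i => ?_
  simp only [entropyGap]
  ring

/-- Two families of positive numbers that are intertwined by a doubly stochastic array supported
on the pairs of equal values agree up to a reindexing. Positivity and summability make the level
sets finite, so that comparing their cardinalities suffices. -/
theorem exists_equiv_of_doublyStochastic {d : ι → κ → ℝ≥0∞} {a : ι → ℝ} {b : κ → ℝ}
    (hrow : ∀ j, ∑' i, d i j = 1) (hcol : ∀ i, ∑' j, d i j = 1)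
    (ha : ∀ i, 0 < a i) (hsum : ∑' i, ENNReal.ofReal (a i) ≠ ∞)
    (hd : ∀ i j, d i j ≠ 0 → b j = a i) :
    ∃ e : ι ≃ κ, ∀ i, b (e i) = a i := by
  have key : ∀ v : ℝ, Nonempty ({i // a i = v} ≃ {j // b j = v}) := by
    intro v
    have h1 : ∀ i : {i // a i = v}, ∑' j : {j // b j = v}, d i j = 1 := fun i => by
      rw [← hcol i]
      refine tsum_subtype_eq_of_support_subset (f := fun j => d i j) (s := {j | b j = v}) ?_
      intro j hj
      exact (hd i j hj).trans i.2
    have h2 : ∀ j : {j // b j = v}, ∑' i : {i // a i = v}, d i j = 1 := fun j => by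
      rw [← hrow j]
      refine tsum_subtype_eq_of_support_subset (f := fun i => d i j) (s := {i | a i = v}) ?_
      intro i hi
      exact (hd i j hi).symm.trans j.2
    have hcard : ENat.card {i // a i = v} = ENat.card {j // b j = v} := by
      rw [← ENat.toENNReal_inj, ← ENNReal.tsum_one, ← ENNReal.tsum_one]
      calc ∑' _ : {i // a i = v}, (1 : ℝ≥0∞)
          = ∑' (i : {i // a i = v}) (j : {j // b j = v}), d i j := by simp_rw [h1]
        _ = ∑' (j : {j // b j = v}) (i : {i // a i = v}), d i j := ENNReal.tsum_comm
        _ = ∑' _ : {j // b j = v}, (1 : ℝ≥0∞) := by simp_rw [h2]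
    have hfin : Finite {i // a i = v} := by
      -- An infinite nonempty level set would contradict the summability of `a`.
      by_cases hne : Nonempty {i // a i = v}
      · obtain ⟨i₀, rfl⟩ := hne
        refine ((ENNReal.finite_const_le_of_tsum_ne_top hsum
          (ENNReal.ofReal_pos.2 (ha i₀)).ne').subset ?_).to_subtype
        intro i hi
        exact le_of_eq (congrArg ENNReal.ofReal hi.symm)
      · rw [not_nonempty_iff] at hne
        infer_instance
    have hfin' : Finite {j // b j = v} := by
      rw [← ENat.card_lt_top, ← hcard]
      exact ENat.card_lt_top_of_finite
    rw [ENat.card_eq_coe_natCard, ENat.card_eq_coe_natCard, Nat.cast_inj] at hcard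
    exact (Finite.card_eq).1 hcard
  exact ⟨Equiv.ofFiberEquiv fun v => (key v).some, fun i => Equiv.ofFiberEquiv_map _ i⟩

/-- If a doubly stochastic array `d` maps the positive summable family `a` to the family `b` and
both have the same finite Shannon entropy, then `b` is a reindexing of `a`. -/
theorem exists_equiv_of_entropy_eq {d : ι → κ → ℝ} {a : ι → ℝ} {b : κ → ℝ}
    (hd : ∀ i j, 0 ≤ d i j) (hrow : ∀ j, HasSum (fun i => d i j) 1)
    (hcol : ∀ i, ∑' j, ENNReal.ofReal (d i j) = 1)
    (hmean : ∀ j, HasSum (fun i => d i j * a i) (b j))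
    (ha : ∀ i, 0 < a i) (ha1 : ∀ i, a i ≤ 1) (hsum : ∑' i, ENNReal.ofReal (a i) ≠ ∞)
    (hS : ∑' j, ENNReal.ofReal (-(b j * Real.logb 2 (b j))) =
      ∑' i, ENNReal.ofReal (-(a i * Real.logb 2 (a i))))
    (hfin : ∑' i, ENNReal.ofReal (-(a i * Real.logb 2 (a i))) ≠ ∞) :
    ∃ e : ι ≃ κ, ∀ i, b (e i) = a i := by
  -- A row of `d` has total mass one, so it charges some positive `a i`.
  have hb : ∀ j, 0 < b j := by
    intro j
    have h0 : ∀ i, 0 ≤ d i j * a i := fun i => mul_nonneg (hd i j) (ha i).le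
    refine lt_of_le_of_ne ((hmean j).nonneg h0) fun h => ?_
    have hz := hmean j
    rw [← h, hasSum_zero_iff_of_nonneg h0] at hz
    have : (fun i => d i j) = 0 := by
      funext i
      exact (mul_eq_zero.1 (congrFun hz i)).resolve_right (ha i).ne'
    have h1 := hrow j
    rw [this] at h1
    exact one_ne_zero (h1.unique hasSum_zero)
  have hηa : ∀ i, 0 ≤ -(a i * Real.logb 2 (a i)) := fun i =>
    neg_mul_logb_nonneg (ha i).le (ha1 i)
  have hgap : ∀ i j, 0 ≤ entropyGap (a i) (b j) := fun i j => entropyGap_nonneg (ha i) (hb j)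
  have hj : ∀ j, ENNReal.ofReal (-(b j * Real.logb 2 (b j))) =
      ∑' i, ENNReal.ofReal (d i j) * ENNReal.ofReal (-(a i * Real.logb 2 (a i))) +
      ∑' i, ENNReal.ofReal (d i j) * ENNReal.ofReal (entropyGap (a i) (b j)) := by
    intro j
    have h := hasSum_mul_add_entropyGap (hrow j) (hmean j)
    rw [← h.tsum_eq, ENNReal.ofReal_tsum_of_nonneg
      (fun i => mul_nonneg (hd i j) (add_nonneg (hηa i) (hgap i j))) h.summable,
      ← ENNReal.tsum_add]
    refine tsum_congr fun i => ?_
    rw [ENNReal.ofReal_mul (hd i j), ENNReal.ofReal_add (hηa i) (hgap i j), mul_add]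
  -- Summing over `j` with `∑ⱼ dᵢⱼ = 1`, the two finite entropies cancel and only the gaps remain.
  have hmain : ∑' i, ENNReal.ofReal (-(a i * Real.logb 2 (a i))) +
      ∑' j, ∑' i, ENNReal.ofReal (d i j) * ENNReal.ofReal (entropyGap (a i) (b j)) =
      ∑' i, ENNReal.ofReal (-(a i * Real.logb 2 (a i))) := by
    conv_rhs => rw [← hS, tsum_congr hj, ENNReal.tsum_add]
    rw [ENNReal.tsum_comm (f := fun j i =>
      ENNReal.ofReal (d i j) * ENNReal.ofReal (-(a i * Real.logb 2 (a i))))]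
    simp_rw [ENNReal.tsum_mul_right, hcol, one_mul]
  have hzero : ∑' j, ∑' i, ENNReal.ofReal (d i j) * ENNReal.ofReal (entropyGap (a i) (b j)) = 0 := by
    exact (ENNReal.add_right_inj hfin).1 (hmain.trans (add_zero _).symm)
  refine exists_equiv_of_doublyStochastic (d := fun i j => ENNReal.ofReal (d i j)) ?_ hcol ha hsum ?_
  · intro j
    rw [← ENNReal.ofReal_tsum_of_nonneg (fun i => hd i j) (hrow j).summable, (hrow j).tsum_eq,
      ENNReal.ofReal_one]
  · intro i j hij
    have h := ENNReal.tsum_eq_zero.1 (ENNReal.tsum_eq_zero.1 hzero j) i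
    have h2 := (mul_eq_zero.1 h).resolve_left hij
    exact eq_of_entropyGap_eq_zero (ha i) (hb j)
      (le_antisymm (ENNReal.ofReal_eq_zero.1 h2) (hgap i j))

end DoublyStochastic

/-! ### Positive operators of finite trace -/

section Operators

variable {H : Type u} [NormedAddCommGroup H] [InnerProductSpace ℂ H]

theorem rankOne_self_nonneg (x : H) : 0 ≤ InnerProductSpace.rankOne ℂ x x :=
  (ContinuousLinearMap.nonneg_iff_isPositive _).2 (InnerProductSpace.isPositive_rankOne_self x)

theorem inner_eq_re_of_nonneg {T : H →L[ℂ] H} (hT : 0 ≤ T) (x : H) :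
    ⟪x, T x⟫_ℂ = ((⟪x, T x⟫_ℂ).re : ℂ) := by
  have h := ((ContinuousLinearMap.nonneg_iff_isPositive T).1 hT).inner_nonneg_right x
  exact Complex.eq_re_of_ofReal_le (r := 0) (by simpa using h)

theorem inner_re_nonneg {T : H →L[ℂ] H} (hT : 0 ≤ T) (x : H) : 0 ≤ (⟪x, T x⟫_ℂ).re :=
  ((ContinuousLinearMap.nonneg_iff_isPositive T).1 hT).re_inner_nonneg_right x

theorem hasSum_norm_inner_sq {ι : Type*} (b : HilbertBasis ι ℂ H) (x : H) :
    HasSum (fun i => ‖⟪b i, x⟫_ℂ‖ ^ 2) (‖x‖ ^ 2) := by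
  convert (b.hasSum_inner_mul_inner x x).mapL Complex.reCLM using 1
  · funext i
    rw [← inner_conj_symm x (b i), ← Complex.normSq_eq_conj_mul_self, Complex.normSq_eq_norm_sq]
    rfl
  · simp [inner_self_eq_norm_sq_to_K, ← Complex.ofReal_pow]

theorem isCompactOperator_rankOne (x y : H) :
    IsCompactOperator (InnerProductSpace.rankOne ℂ x y) := by
  rw [InnerProductSpace.rankOne_def']
  exact (isCompactOperator_of_locallyCompactSpace_rng
    (ContinuousLinearMap.toSpanSingleton ℂ x)).comp_clm _

theorem mem_spectrum_of_apply_eq_smul {T : H →L[ℂ] H} {x : H} {a : ℝ} (hx0 : x ≠ 0)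
    (hx : T x = (a : ℂ) • x) : a ∈ spectrum ℝ T := by
  rw [spectrum.mem_iff]
  intro hu
  obtain ⟨S, hS⟩ := hu.exists_left_inv
  apply hx0
  have : (S * (algebraMap ℝ (H →L[ℂ] H) a - T)) x = x := by rw [hS]; rfl
  rw [← this]
  simp [Algebra.algebraMap_eq_smul_one, hx]

theorem re_inner_of_apply_eq_smul {T : H →L[ℂ] H} {x : H} {a : ℝ} (hx1 : ‖x‖ = 1)
    (hx : T x = (a : ℂ) • x) : (⟪x, T x⟫_ℂ).re = a := by
  simp [hx, inner_self_eq_norm_sq_to_K, hx1]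

variable [CompleteSpace H]

theorem inner_sqrt_left (T : H →L[ℂ] H) (x y : H) :
    ⟪CFC.sqrt T x, y⟫_ℂ = ⟪x, CFC.sqrt T y⟫_ℂ :=
  (CFC.sqrt_nonneg T).isSelfAdjoint.isSymmetric x y

theorem re_inner_eq_norm_sqrt_sq {T : H →L[ℂ] H} (hT : 0 ≤ T) (x : H) :
    (⟪x, T x⟫_ℂ).re = ‖CFC.sqrt T x‖ ^ 2 := by
  have h : T x = CFC.sqrt T (CFC.sqrt T x) := by
    conv_lhs => rw [← CFC.sqrt_mul_sqrt_self T hT]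
    rfl
  rw [h, ← inner_sqrt_left, inner_self_eq_norm_sq_to_K]
  simp [← Complex.ofReal_pow]

theorem isTraceClass_of_nonneg_iff {T : H →L[ℂ] H} (hT : 0 ≤ T) :
    IsTraceClass T ↔ posTrace T < ∞ := by
  rw [IsTraceClass, CFC.abs_of_nonneg T hT]

theorem ofReal_trace_re {T : H →L[ℂ] H} (hT : 0 ≤ T) (h : IsTraceClass T) :
    ENNReal.ofReal (trace T).re = posTrace T := by
  rw [isTraceClass_of_nonneg_iff hT] at h
  have hs : Summable fun i => (⟪chosenBasis H i, T (chosenBasis H i)⟫_ℂ).re := by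
    have := ENNReal.summable_toReal h.ne
    simpa only [ENNReal.toReal_ofReal (inner_re_nonneg hT _)] using this
  have : trace T = ((∑' i, (⟪chosenBasis H i, T (chosenBasis H i)⟫_ℂ).re : ℝ) : ℂ) := by
    rw [trace, Complex.ofReal_tsum]
    exact tsum_congr fun i => inner_eq_re_of_nonneg hT _
  rw [this, Complex.ofReal_re, ENNReal.ofReal_tsum_of_nonneg (fun i => inner_re_nonneg hT _) hs]
  rfl

theorem IsDensityOperator.posTrace_eq_one {ρ : H →L[ℂ] H} (hρ : IsDensityOperator ρ) :
    posTrace ρ = 1 := by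
  rw [← ofReal_trace_re hρ.nonneg hρ.isTraceClass, hρ.trace_eq_one]
  simp

theorem posTrace_rankOne_self {e : H} (he : ‖e‖ = 1) :
    posTrace (InnerProductSpace.rankOne ℂ e e) = 1 := by
  have h := tsum_enorm_inner_sq (chosenBasis H) e
  rw [he, one_pow, ENNReal.ofReal_one] at h
  rw [posTrace, ← h]
  refine tsum_congr fun i => ?_
  congr 1
  rw [InnerProductSpace.rankOne_apply, inner_smul_right, ← inner_conj_symm,
    ← Complex.normSq_eq_conj_mul_self, Complex.normSq_eq_norm_sq, Complex.ofReal_re]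

theorem summable_norm_sqrt_sq {T : H →L[ℂ] H} (hT : 0 ≤ T) (h : posTrace T < ∞) :
    Summable fun i => ‖CFC.sqrt T (chosenBasis H i)‖ ^ 2 := by
  have := ENNReal.summable_toReal h.ne
  simp only [ENNReal.toReal_ofReal (inner_re_nonneg hT _)] at this
  simpa only [re_inner_eq_norm_sqrt_sq hT] using this

/-- With `P` the projection onto the basis vectors indexed by `F`, the operator `(1 - P) √T` is
bounded by its Hilbert–Schmidt norm. For finite trace this makes `√T` a norm limit of finite rank
operators, and `F = ∅` gives a bound for `√T` itself. -/
theorem norm_sub_sum_rankOne_sq_le {T : H →L[ℂ] H} (hT : 0 ≤ T) (h : posTrace T < ∞)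
    (F : Finset (basisIndex H)) (x : H) :
    ‖(CFC.sqrt T - ∑ i ∈ F, InnerProductSpace.rankOne ℂ (chosenBasis H i)
      (CFC.sqrt T (chosenBasis H i))) x‖ ^ 2 ≤
      (∑' i, ‖CFC.sqrt T (chosenBasis H i)‖ ^ 2 - ∑ i ∈ F, ‖CFC.sqrt T (chosenBasis H i)‖ ^ 2) *
        ‖x‖ ^ 2 := by
  classical
  set b := chosenBasis H
  set S := CFC.sqrt T
  have hs : Summable fun i => ‖S (b i)‖ ^ 2 := summable_norm_sqrt_sq hT h
  have hs' : HasSum (fun i => if i ∈ F then 0 else ‖S (b i)‖ ^ 2)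
      (∑' i, ‖S (b i)‖ ^ 2 - ∑ i ∈ F, ‖S (b i)‖ ^ 2) := by
    have h1 : HasSum (fun i => if i ∈ F then ‖S (b i)‖ ^ 2 else 0) (∑ i ∈ F, ‖S (b i)‖ ^ 2) := by
      have h2 : ∑ i ∈ F, ‖S (b i)‖ ^ 2 = ∑ i ∈ F, if i ∈ F then ‖S (b i)‖ ^ 2 else 0 :=
        Finset.sum_congr rfl fun i hi => by rw [if_pos hi]
      rw [h2]
      exact hasSum_sum_of_ne_finset_zero fun i hi => if_neg hi
    refine (hs.hasSum.sub h1).congr_fun fun i => ?_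
    split_ifs <;> simp
  refine hasSum_le (fun j => ?_) (hasSum_norm_inner_sq b _) (hs'.mul_right _)
  have hcoef : ⟪b j, (S - ∑ i ∈ F, InnerProductSpace.rankOne ℂ (b i) (S (b i))) x⟫_ℂ =
      if j ∈ F then 0 else ⟪S (b j), x⟫_ℂ := by
    have hb := orthonormal_iff_ite.1 b.orthonormal
    simp only [_root_.sub_apply, _root_.sum_apply, inner_sub_right,
      inner_sum, InnerProductSpace.rankOne_apply, inner_smul_right, hb, mul_ite, mul_one, mul_zero,
      Finset.sum_ite_eq, S, inner_sqrt_left]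
    split_ifs <;> simp
  rw [hcoef]
  split_ifs
  · simp
  · rw [← mul_pow]
    gcongr
    exact norm_inner_le_norm _ _

theorem isCompactOperator_of_posTrace_lt_top {T : H →L[ℂ] H} (hT : 0 ≤ T) (h : posTrace T < ∞) :
    IsCompactOperator T := by
  have hS : IsCompactOperator ⇑(CFC.sqrt T : H →L[ℂ] H) := by
    refine isCompactOperator_of_tendsto (l := Filter.atTop)
      (F := fun F : Finset (basisIndex H) => ∑ i ∈ F, InnerProductSpace.rankOne ℂ
        (chosenBasis H i) (CFC.sqrt T (chosenBasis H i))) ?_ (Filter.Eventually.of_forall fun F => ?_)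
    · rw [tendsto_iff_norm_sub_tendsto_zero]
      have hs := (summable_norm_sqrt_sq hT h).hasSum
      have hlim := (((tendsto_const_nhds (x := ∑' i, ‖CFC.sqrt T (chosenBasis H i)‖ ^ 2)).sub
        hs).sqrt)
      rw [sub_self, Real.sqrt_zero] at hlim
      refine squeeze_zero (fun _ => norm_nonneg _) (fun F => ?_) hlim
      rw [norm_sub_rev]
      refine ContinuousLinearMap.opNorm_le_bound _ (Real.sqrt_nonneg _) fun x => ?_
      refine (sq_le_sq₀ (norm_nonneg _) (by positivity)).1 ?_
      rw [mul_pow, Real.sq_sqrt (sub_nonneg.2 ((summable_norm_sqrt_sq hT h).sum_le_tsum F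
        fun i _ => by positivity))]
      exact norm_sub_sum_rankOne_sq_le hT h F x
    · have : ∑ i ∈ F, InnerProductSpace.rankOne ℂ (chosenBasis H i)
          (CFC.sqrt T (chosenBasis H i)) ∈ compactOperator (RingHom.id ℂ) H H :=
        Submodule.sum_mem _ fun i _ => isCompactOperator_rankOne _ _
      exact this
  have h2 := hS.comp_clm (CFC.sqrt T)
  have h3 : ⇑(CFC.sqrt T : H →L[ℂ] H) ∘ ⇑(CFC.sqrt T : H →L[ℂ] H) = T := by
    conv_rhs => rw [← CFC.sqrt_mul_sqrt_self T hT]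
    rfl
  rwa [h3] at h2

theorem re_inner_le_of_posTrace_eq_one {T : H →L[ℂ] H} (hT : 0 ≤ T) (h : posTrace T = 1) (x : H) :
    (⟪x, T x⟫_ℂ).re ≤ ‖x‖ ^ 2 := by
  have h1 := norm_sub_sum_rankOne_sq_le hT (h ▸ ENNReal.one_lt_top) ∅ x
  have h2 : ∑' i, ‖CFC.sqrt T (chosenBasis H i)‖ ^ 2 = 1 := by
    rw [← ENNReal.toReal_one, ← h, posTrace, ENNReal.tsum_toReal_eq fun _ => ENNReal.ofReal_ne_top]
    refine tsum_congr fun i => ?_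
    rw [ENNReal.toReal_ofReal (inner_re_nonneg hT _), re_inner_eq_norm_sqrt_sq hT]
  rw [re_inner_eq_norm_sqrt_sq hT]
  simpa [h2] using h1

theorem le_one_of_posTrace_eq_one {T : H →L[ℂ] H} (hT : 0 ≤ T) (h : posTrace T = 1) : T ≤ 1 := by
  rw [ContinuousLinearMap.le_def, ContinuousLinearMap.isPositive_iff_complex]
  intro x
  have h1 := re_inner_le_of_posTrace_eq_one hT h x
  have h2 : ⟪(1 - T) x, x⟫_ℂ = ((‖x‖ ^ 2 - (⟪x, T x⟫_ℂ).re : ℝ) : ℂ) := by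
    rw [_root_.sub_apply, inner_sub_left, ← inner_conj_symm (T x) x, inner_eq_re_of_nonneg hT x,
      Complex.conj_ofReal]
    simp [inner_self_eq_norm_sq_to_K]
  rw [h2]
  exact ⟨rfl, sub_nonneg.2 h1⟩

/-! ### Eigenvector bases and entropy -/

/-- A positive operator of finite trace has an orthonormal basis of eigenvectors. -/
theorem exists_hilbertBasis_eigenvectors {T : H →L[ℂ] H} (hT : 0 ≤ T) (h : posTrace T < ∞) :
    ∃ (ι : Type u) (b : HilbertBasis ι ℂ H) (a : ι → ℝ), ∀ i, T (b i) = (a i : ℂ) • b i := by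
  have hsymm : (T : H →ₗ[ℂ] H).IsSymmetric := hT.isSelfAdjoint.isSymmetric
  have hbot := ContinuousLinearMap.orthogonalComplement_iSup_eigenspaces_eq_bot
    (isCompactOperator_of_posTrace_lt_top hT h) hsymm
  let E : ℂ → Submodule ℂ H := fun μ => Module.End.eigenspace (T : H →ₗ[ℂ] H) μ
  have hclosed : ∀ μ, IsClosed (E μ : Set H) := fun μ => by
    have : (E μ : Set H) = {x | T x = μ • x} := by
      ext x
      exact Module.End.mem_eigenspace_iff
    rw [this]
    exact isClosed_eq T.continuous (continuous_const_smul μ)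
  have hcomplete : ∀ μ, CompleteSpace (E μ) := fun μ => (hclosed μ).completeSpace_coe
  choose w B hB using fun μ => exists_hilbertBasis ℂ (E μ)
  have hortho := hsymm.orthogonalFamily_eigenspaces.orthonormal_sigma_orthonormal
    (v_family := fun μ => B μ) (fun μ => (B μ).orthonormal)
  have hspan : (Submodule.span ℂ (Set.range fun p : Σ μ, w μ => (E p.1).subtypeₗᵢ (B p.1 p.2)))ᗮ
      = ⊥ := by
    -- A vector orthogonal to a basis of each eigenspace is orthogonal to all eigenspaces.
    rw [eq_bot_iff, ← hbot, ← Submodule.iInf_orthogonal]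
    intro x hx
    refine Submodule.mem_iInf _ |>.2 fun μ => ?_
    rw [Submodule.mem_orthogonal']
    intro u hu
    have hu' := (((B μ).hasSum_repr ⟨u, hu⟩).mapL (E μ).subtypeL).mapL (innerSL ℂ x)
    refine hu'.unique ?_
    convert hasSum_zero with i
    have := (Submodule.mem_orthogonal' _ x).1 hx _ (Submodule.subset_span ⟨⟨μ, i⟩, rfl⟩)
    simp only [map_smul, Submodule.subtypeL_apply, innerSL_apply_apply, smul_eq_mul]
    exact mul_eq_zero_of_right _ this
  refine ⟨Σ μ : ℂ, w μ, HilbertBasis.mkOfOrthogonalEqBot hortho hspan, fun p => p.1.re, fun p => ?_⟩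
  rw [HilbertBasis.coe_mkOfOrthogonalEqBot]
  have hp : T ((E p.1).subtypeₗᵢ (B p.1 p.2)) = p.1 • (E p.1).subtypeₗᵢ (B p.1 p.2) :=
    Module.End.mem_eigenspace_iff.1 (B p.1 p.2).2
  -- The eigenvalues of a positive operator are real.
  have hre : p.1 = (p.1.re : ℂ) := by
    have h1 := inner_eq_re_of_nonneg hT ((E p.1).subtypeₗᵢ (B p.1 p.2))
    have h2 : ⟪(E p.1).subtypeₗᵢ (B p.1 p.2), T ((E p.1).subtypeₗᵢ (B p.1 p.2))⟫_ℂ = p.1 := by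
      rw [hp, inner_smul_right, inner_self_eq_norm_sq_to_K, hortho.1 p]
      simp
    rwa [h2] at h1
  rw [← hre]
  exact hp

/-- The functions `f` with this property form a closed subalgebra of `C(spectrum ℝ T, ℝ)` containing
the identity, which is everything by the Weierstrass approximation theorem. -/
theorem cfcHom_apply_eigenvector {T : H →L[ℂ] H} (hT : IsSelfAdjoint T) {x : H} {a : ℝ}
    (hx : T x = (a : ℂ) • x) (ha : a ∈ spectrum ℝ T) (f : C(spectrum ℝ T, ℝ)) :
    cfcHom hT f x = ((f ⟨a, ha⟩ : ℝ) : ℂ) • x := by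
  have hid : cfcHom hT (.restrict (spectrum ℝ T) (.id ℝ)) x =
      (((ContinuousMap.restrict (spectrum ℝ T) (.id ℝ)) ⟨a, ha⟩ : ℝ) : ℂ) • x := by
    rw [cfcHom_id hT]
    exact hx
  induction f using ContinuousMap.induction_on_of_compact with
  | const r =>
    have : ContinuousMap.const (spectrum ℝ T) r = algebraMap ℝ C(spectrum ℝ T, ℝ) r := rfl
    rw [this, AlgHomClass.commutes]
    simp [Algebra.algebraMap_eq_smul_one]
  | id => exact hid
  | star_id => rwa [star_trivial]
  | add f g hf hg => simp [hf, hg, add_smul]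
  | mul f g hf hg => 
    rw [map_mul, mul_apply_eq_comp, hg, map_smul, hf, smul_smul, mul_comm,
      ContinuousMap.mul_apply, Complex.ofReal_mul]
  | frequently f hf =>
    have hc : IsClosed {g : C(spectrum ℝ T, ℝ) | cfcHom hT g x = ((g ⟨a, ha⟩ : ℝ) : ℂ) • x} := by
      refine isClosed_eq ?_ ?_
      · exact (ContinuousLinearMap.apply ℂ H x).continuous.comp (cfcHom_continuous hT)
      · exact (Complex.continuous_ofReal.comp
          (continuous_eval_const (F := C(spectrum ℝ T, ℝ)) _)).smul continuous_const
    exact hc.mem_of_frequently_of_tendsto hf Filter.tendsto_id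

/-- An eigenvector of `T` for `a` is an eigenvector of `f(T)` for `f a`. -/
theorem cfc_apply_eigenvector {T : H →L[ℂ] H} (hT : IsSelfAdjoint T) {x : H} {a : ℝ}
    (hx0 : x ≠ 0) (hx : T x = (a : ℂ) • x) {f : ℝ → ℝ} (hf : Continuous f) :
    cfc f T x = ((f a : ℝ) : ℂ) • x := by
  rw [cfc_apply f T hT hf.continuousOn]
  exact cfcHom_apply_eigenvector hT hx (mem_spectrum_of_apply_eq_smul hx0 hx) _

theorem continuous_neg_mul_logb : Continuous fun x : ℝ => -(x * Real.logb 2 x) := by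
  have : (fun x : ℝ => -(x * Real.logb 2 x)) = fun x => -(x * Real.log x / Real.log 2) := by
    funext x
    rw [Real.logb, mul_div_assoc]
  rw [this]
  exact (Real.continuous_mul_log.div_const _).neg

/-- The von Neumann entropy is the Shannon entropy of the eigenvalues. -/
theorem entropy_eq_tsum {T : H →L[ℂ] H} (hT : 0 ≤ T) (h : posTrace T = 1) {ι : Type*}
    (b : HilbertBasis ι ℂ H) {a : ι → ℝ} (hb : ∀ i, T (b i) = (a i : ℂ) • b i) :
    entropy T = ∑' i, ENNReal.ofReal (-(a i * Real.logb 2 (a i))) := by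
  have hle : ∀ x ∈ spectrum ℝ T, x ≤ 1 := by
    rw [← le_algebraMap_iff_spectrum_le (ha := hT.isSelfAdjoint), map_one]
    exact le_one_of_posTrace_eq_one hT h
  have hnn : 0 ≤ cfc (fun x : ℝ => -(x * Real.logb 2 x)) T :=
    cfc_nonneg fun x hx => neg_mul_logb_nonneg (spectrum_nonneg_of_nonneg hT hx) (hle x hx)
  rw [entropy, posTrace_eq hnn b]
  refine tsum_congr fun i => ?_
  rw [re_inner_of_apply_eq_smul (b.orthonormal.1 i) (cfc_apply_eigenvector hT.isSelfAdjoint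
    (b.orthonormal.ne_zero i) (hb i) continuous_neg_mul_logb)]

end Operators

/-! ### Normal maps -/

variable {H : Type u} [NormedAddCommGroup H] [InnerProductSpace ℂ H]

theorem norm_sum_inner_smul_le {ι : Type*} (b : HilbertBasis ι ℂ H) (F : Finset ι) (x : H) :
    ‖∑ i ∈ F, ⟪b i, x⟫_ℂ • b i‖ ≤ ‖x‖ := by
  classical
  refine (sq_le_sq₀ (norm_nonneg _) (norm_nonneg _)).1 ?_
  refine hasSum_le (fun j => ?_) (hasSum_norm_inner_sq b _) (hasSum_norm_inner_sq b x)
  have hb := orthonormal_iff_ite.1 b.orthonormal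
  have : ⟪b j, ∑ i ∈ F, ⟪b i, x⟫_ℂ • b i⟫_ℂ = if j ∈ F then ⟪b j, x⟫_ℂ else 0 := by
    simp [hb]
  rw [this]
  split_ifs
  · rfl
  · simp

/-- Vector states are ultraweakly continuous: they come from square summable sequences with a single
nonzero entry. -/
theorem continuous_inner_ultraweak (y : H) :
    Continuous[ultraweakTopology H, inferInstance] fun T : H →L[ℂ] H => ⟪y, T y⟫_ℂ := by
  have h : (fun T : H →L[ℂ] H => ⟪y, T y⟫_ℂ) = fun T : H →L[ℂ] H =>
      ∑' n, ⟪(lp.single 2 0 y : lp (fun _ : ℕ => H) 2) n,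
        T ((lp.single 2 0 y : lp (fun _ : ℕ => H) 2) n)⟫_ℂ := by
    funext T
    rw [tsum_eq_single 0 fun n hn => by simp [hn]]
    simp
  rw [h]
  exact continuous_iInf_dom (i := ((lp.single 2 0 y : lp (fun _ : ℕ => H) 2),
    (lp.single 2 0 y : lp (fun _ : ℕ => H) 2))) continuous_induced_dom

/-- Cutting an operator off by the finite partial sums of a resolution of the identity into rank
one projections converges ultraweakly, by dominated convergence. -/
theorem tendsto_sum_mul_rankOne_ultraweak {ι : Type*} (b : HilbertBasis ι ℂ H) (A : H →L[ℂ] H) :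
    Filter.Tendsto (fun F : Finset ι => ∑ i ∈ F, A * InnerProductSpace.rankOne ℂ (b i) (b i))
      Filter.atTop (@nhds _ (ultraweakTopology H) A) := by
  rw [nhds_iInf, Filter.tendsto_iInf]
  rintro ⟨x, y⟩
  rw [nhds_induced, Filter.tendsto_comap_iff]
  have happ : ∀ (F : Finset ι) (z : H),
      (∑ i ∈ F, A * InnerProductSpace.rankOne ℂ (b i) (b i)) z =
        A (∑ i ∈ F, ⟪b i, z⟫_ℂ • b i) := fun F z => by simp
  refine tendsto_tsum_of_dominated_convergence (bound := fun n => ‖y n‖ * (‖A‖ * ‖x n‖)) ?_ ?_ ?_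
  · have hx := (lp.memℓp x).summable (by norm_num)
    have hy := (lp.memℓp y).summable (by norm_num)
    have := Real.summable_mul_of_Lp_Lq_of_nonneg (p := 2) (q := 2) Real.HolderConjugate.two_two
      (fun n => norm_nonneg (y n)) (fun n => norm_nonneg (x n)) (by simpa using hy)
      (by simpa using hx)
    refine (this.mul_left ‖A‖).congr fun n => by ring
  · intro n
    simp only [happ]
    have h := b.hasSum_repr (x n)
    simp only [b.repr_apply_apply] at h
    exact ((innerSL ℂ (y n)).continuous.comp A.continuous).continuousAt.tendsto.comp h
  · refine Filter.Eventually.of_forall fun F n => ?_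
    simp only [happ]
    refine (norm_inner_le_norm _ _).trans ?_
    gcongr
    exact (A.le_opNorm _).trans (by gcongr; exact norm_sum_inner_smul_le b F _)

variable [CompleteSpace H]

/-- For a normal map, the images of the rank one projections onto an orthonormal basis sum weakly
to the image of the identity; more generally this holds after multiplication by any `A`. -/
theorem IsNormal.hasSum_inner {Φ : (H →L[ℂ] H) →CP (H →L[ℂ] H)} (hΦ : IsNormal Φ) {ι : Type*}
    (b : HilbertBasis ι ℂ H) (A : H →L[ℂ] H) (y : H) :
    HasSum (fun i => ⟪y, Φ (A * InnerProductSpace.rankOne ℂ (b i) (b i)) y⟫_ℂ) ⟪y, Φ A y⟫_ℂ := by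
  have hc : Continuous[ultraweakTopology H, inferInstance] fun T : H →L[ℂ] H => ⟪y, Φ T y⟫_ℂ :=
    @Continuous.comp _ _ _ (ultraweakTopology H) (ultraweakTopology H) _ _ _
      (continuous_inner_ultraweak y) hΦ
  have h := (@Continuous.tendsto _ _ (ultraweakTopology H) _ _ hc A).comp
    (tendsto_sum_mul_rankOne_ultraweak b A)
  refine h.congr fun F => ?_
  simp [map_sum]

/-! ### Bi-stochastic operations -/

theorem IsBistochastic.isDensityOperator_map {Φ : (H →L[ℂ] H) →CP (H →L[ℂ] H)}
    (hΦ : IsBistochastic Φ) {ρ : H →L[ℂ] H} (hρ : IsDensityOperator ρ) :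
    IsDensityOperator (Φ ρ) where
  nonneg := map_nonneg Φ hρ.nonneg
  isTraceClass := (hΦ.isTracePreserving ρ hρ.isTraceClass).1
  trace_eq_one := (hΦ.isTracePreserving ρ hρ.isTraceClass).2.trans hρ.trace_eq_one

theorem IsBistochastic.posTrace_map {Φ : (H →L[ℂ] H) →CP (H →L[ℂ] H)}
    (hΦ : IsBistochastic Φ) {T : H →L[ℂ] H} (hT : 0 ≤ T) (h : posTrace T < ∞) :
    posTrace (Φ T) = posTrace T := by
  have htc := (isTraceClass_of_nonneg_iff hT).2 h
  have hΦT := hΦ.isTracePreserving T htc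
  rw [← ofReal_trace_re hT htc, ← ofReal_trace_re (map_nonneg Φ hT) hΦT.1, hΦT.2]

/-! ### Unitary equivalence of diagonal operators -/

theorem exists_unitary_apply_eq {ι κ : Type*} (b : HilbertBasis ι ℂ H) (c : HilbertBasis κ ℂ H)
    (e : ι ≃ κ) : ∃ U ∈ unitary (H →L[ℂ] H), ∀ i, U (b i) = c (e i) := by
  classical
  let c' : HilbertBasis ι ℂ H := HilbertBasis.mk (v := c ∘ e)
    (c.orthonormal.comp e e.injective) (by
      rw [e.surjective.range_comp, c.dense_span])
  refine ⟨Unitary.linearIsometryEquiv.symm (b.repr.trans c'.repr.symm), Subtype.property _,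
    fun i => ?_⟩
  rw [Unitary.coe_symm_linearIsometryEquiv_apply]
  change c'.repr.symm (b.repr (b i)) = c (e i)
  rw [b.repr_self, c'.repr_symm_single]
  exact congrFun (HilbertBasis.coe_mk _ _) i

/-- Operators diagonal in two orthonormal bases with the same eigenvalues, up to a reindexing, are
unitarily equivalent. -/
theorem exists_unitary_conj {ι κ : Type*} {S T : H →L[ℂ] H} (b : HilbertBasis ι ℂ H)
    (c : HilbertBasis κ ℂ H) {s : ι → ℝ} {t : κ → ℝ} (hS : ∀ i, S (b i) = (s i : ℂ) • b i)
    (hT : ∀ j, T (c j) = (t j : ℂ) • c j) (e : ι ≃ κ) (he : ∀ i, t (e i) = s i) :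
    ∃ U ∈ unitary (H →L[ℂ] H), T = U * S * star U := by
  obtain ⟨U, hU, hUb⟩ := exists_unitary_apply_eq b c e
  refine ⟨U, hU, ?_⟩
  have hcomm : T * U = U * S := by
    refine ContinuousLinearMap.ext_on (s := Set.range b) ?_ ?_
    · rw [Submodule.dense_iff_topologicalClosure_eq_top]
      exact b.dense_span
    · rintro _ ⟨i, rfl⟩
      simp [hS, hUb, hT, he]
  rw [← hcomm, mul_assoc, Unitary.mul_star_self_of_mem hU, mul_one]

end QuantumEntropy

theorem proposition3p5 {H : Type*} [NormedAddCommGroup H] [InnerProductSpace ℂ H]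
    [CompleteSpace H] [TopologicalSpace.SeparableSpace H]
    (Φ : (H →L[ℂ] H) →CP (H →L[ℂ] H)) (hΦ : QuantumEntropy.IsBistochastic Φ)
    (ρ : H →L[ℂ] H) (hρ : QuantumEntropy.IsDensityOperator ρ) (hinj : Function.Injective ρ)
    (hS : QuantumEntropy.entropy (Φ ρ) = QuantumEntropy.entropy ρ)
    (hfin : QuantumEntropy.entropy ρ < ⊤) :
    ∃ U ∈ unitary (H →L[ℂ] H), Φ ρ = U * ρ * star U := by
  open QuantumEntropy InnerProductSpace in
  have hσ := hΦ.isDensityOperator_map hρ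
  have hρ1 := hρ.posTrace_eq_one
  have hσ1 := hσ.posTrace_eq_one
  obtain ⟨ι, e, a, he⟩ := exists_hilbertBasis_eigenvectors hρ.nonneg (by simp [hρ1])
  obtain ⟨κ, f, b, hf⟩ := exists_hilbertBasis_eigenvectors hσ.nonneg (by simp [hσ1])
  rw [entropy_eq_tsum hσ.nonneg hσ1 f hf, entropy_eq_tsum hρ.nonneg hρ1 e he] at hS
  rw [entropy_eq_tsum hρ.nonneg hρ1 e he] at hfin
  have hae : ∀ i, (⟪e i, ρ (e i)⟫_ℂ).re = a i := fun i =>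
    re_inner_of_apply_eq_smul (e.orthonormal.1 i) (he i)
  have hP : ∀ i, 0 ≤ Φ (rankOne ℂ (e i) (e i)) := fun i =>
    map_nonneg Φ (rankOne_self_nonneg _)
  -- The array of transition probabilities `dᵢⱼ = ⟨fⱼ, Φ(|eᵢ⟩⟨eᵢ|) fⱼ⟩`.
  obtain ⟨π, hπ⟩ := exists_equiv_of_entropy_eq
    (d := fun i j => (⟪f j, Φ (rankOne ℂ (e i) (e i)) (f j)⟫_ℂ).re) (a := a) (b := b)
    (fun i j => inner_re_nonneg (hP i) _)
    (fun j => by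
      have h := (hΦ.isNormal.hasSum_inner e 1 (f j)).mapL Complex.reCLM
      simpa [hΦ.map_one, f.orthonormal.1 j] using h)
    (fun i => by
      have h1 := posTrace_rankOne_self (e.orthonormal.1 i)
      rw [← posTrace_eq (hP i) f, hΦ.posTrace_map (rankOne_self_nonneg _) (by simp [h1]), h1])
    (fun j => by
      have h := (hΦ.isNormal.hasSum_inner e ρ (f j)).mapL Complex.reCLM
      have h1 : ∀ i, ρ * rankOne ℂ (e i) (e i) = (a i : ℂ) • rankOne ℂ (e i) (e i) := fun i => by
        ext x
        rw [mul_apply_eq_comp, rankOne_apply, map_smul, he, smul_comm]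
        rfl
      simp only [h1, map_smul, _root_.smul_apply, inner_smul_right, Complex.reCLM_apply,
        Complex.re_ofReal_mul, re_inner_of_apply_eq_smul (f.orthonormal.1 j) (hf j)] at h
      simpa only [mul_comm] using h)
    (fun i => by
      refine lt_of_le_of_ne (hae i ▸ inner_re_nonneg hρ.nonneg _) fun h0 => ?_
      refine e.orthonormal.ne_zero i (hinj ?_)
      rw [he, ← h0, map_zero, Complex.ofReal_zero, zero_smul])
    (fun i => by
      have h := re_inner_le_of_posTrace_eq_one hρ.nonneg hρ1 (e i)
      rwa [hae, e.orthonormal.1 i, one_pow] at h)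
    (by
      rw [posTrace_eq hρ.nonneg e] at hρ1
      simp only [hae] at hρ1
      simp [hρ1])
    hS hfin.ne
  exact exists_unitary_conj e f he hf π hπ
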